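/- **Proposition 2.1.** Let $\mu\neq 0$ and consider the flat slow-fast model $$\dot x=\varepsilon\mu e^{-1/y},\qquad \dot y=y^2\,(x-e^{-1/y}),\qquad y>0,\ 0<\varepsilon\ll 1, \tag{1}$$ with critical manifold $S_a:\ x=e^{-1/y}$. With $q=e^{-1/y}$ it extends to $\dot x=\varepsilon\mu q,\ \dot y=y^2(x-q),\ \dot q=q(x-q),\ \dot\varepsilon=0$, and in the blowup chart $\kappa_1:\ x=r_1x_1,\ q=r_1,\ \varepsilon=r_1\epsilon_1$ this becomes, after division by $r_1$, $$\dot r_1=r_1(x_1-1),\quad \dot x_1=(1-x_1)x_1+\epsilon_1\mu,\quad \dot y=y^2(x_1-1),\quad \dot\epsilon_1=(1-x_1)\epsilon_1. \tag{2}$$ Put $\rho(\delta)=e^{-1/\delta}$, $U_1=\{r_1\in[0,\rho(\delta)],\ x_1\in[0,\xi^{-1}],\ y\in[0,\delta],\ \epsilon_1\in[0,\nu]\}$ and $S_{a,1}:\ x_1=1,\ \epsilon_1=0$. There are $K,\delta_0,\nu_0,\xi_0>0$, depending only on $\mu$, such that for all $\delta\in(0,\delta_0]$, $\nu\in(0,\nu_0]$,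 $\xi\in(0,\xi_0]$ the following holds. 1. There is a $C^\infty$ function $h(r_1,y,\epsilon_1)$ with $|h|\le K\epsilon_1$ on $[0,\rho(\delta)]\times[0,\delta]\times[0,\nu]$ such that the graph over that set $$M_1:\quad x_1=1+\epsilon_1\mu\,(1+h(r_1,y,\epsilon_1))=1+\epsilon_1\mu(1+\mathcal O(\epsilon_1))$$ is contained in $U_1$ and is a center manifold of (2) within $U_1$ for each equilibrium $(r_1,x_1,y,\epsilon_1)=(0,1,y,0)$, $y\in[0,\delta]$. That is, it is a smooth submanifold through the equilibrium, locally invariant within $U_1$, of the dimension of the center subspace of the linearization and tangent to that subspace at the equilibrium. 2. $M_1\cap\{\epsilon_1=0\}=S_{a,1}\cap U_1$, and $S_{a,1}$ consists of equilibria of (2). 3. The plane $r_1=y=0$ is invariant, and $C_1=M_1\cap\{r_1=y=0\}$, which is $x_1=1+\epsilon_1\mu(1+h(0,0,\epsilon_1))$, is, in the coordinates $(x_1,\epsilon_1)$, a center manifold of the equilibrium $(1,0)$ of the flow in this plane, within $[0,\xi^{-1}]\times[0,\nu]$. 4. If $\mu<0$, then $C_1$ is overflowing: solutions from points of $C_1$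 exist and stay in $C_1$ for all negative times, and the vector field points strictly outward at the boundary $\epsilon_1=\nu$; moreover $\dot\epsilon_1>0$ on $C_1\cap\{\epsilon_1>0\}$. If $\mu>0$, then $C_1$ is inflowing (the same with time reversed), and $\dot\epsilon_1<0$ on $C_1\cap\{\epsilon_1>0\}$. 5. Consequently the slow manifold of (1) extends up to a neighbourhood of $(x,y)=0$ that scales like $(x,y)=(\mathcal O(\varepsilon),\mathcal O(1/\ln\varepsilon^{-1}))$. Precisely, there is a function $X(\varepsilon,y)$, smooth for $y>0$, with $X(0,y)=e^{-1/y}$, such that for $0<\varepsilon<\nu\rho(\delta)$ and $y_\varepsilon:=1/\ln(\nu/\varepsilon)\in(0,\delta)$: - the set $M_1\cap\{r_1=e^{-1/y}\}\cap\{r_1\epsilon_1=\varepsilon\}$, mapped to the $(x,y)$-plane by $\kappa_1$, is the graph $x=X(\varepsilon,y)$, $y\in[y_\varepsilon,\delta]$; - this graph is locally invariant for (1) within the strip $y_\varepsilon\le y\le\delta$, and $|X(\varepsilon,y)-e^{-1/y}|\le K\varepsilon$ on $[y_\varepsilon,\delta]$; - $|X(\varepsilon,y_\varepsilon)-\frac{\varepsilon}{\nu}(1+\nu\mu)|\le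 K\varepsilon\nu$ at its end point $y=y_\varepsilon$. The graph extends the slow manifold $S_{a,\varepsilon}$: if $0<a<\delta<b$ and $x=Y(\varepsilon,y)$, $y\in[a,b]$, is any family of $C^1$ graphs that for all small $\varepsilon>0$ are locally invariant for (1) within $a\le y\le b$ and satisfy $Y(\varepsilon,y)=e^{-1/y}+\mathcal O(\varepsilon)$ uniformly on $[a,b]$, then $Y(\varepsilon,\delta)-X(\varepsilon,\delta)=\mathcal O(e^{-c/\varepsilon})$ for some $c>0$. Finally, as $\varepsilon\to0^+$, $X(\varepsilon,y_\varepsilon)=\mathcal O(\varepsilon)$ and $y_\varepsilon=\mathcal O(1/\ln\varepsilon^{-1})$. -/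

import Mathlib

open Set Filter Topology Asymptotics
open scoped ContDiff TensorProduct

namespace FlatSlow

/-! ### Invariant sets and center manifolds of a vector field -/

section General

variable {E : Type*} [NormedAddCommGroup E] [NormedSpace ℝ E]

/-- `M` is locally invariant within `U` for `z' = F z`: a solution, on any time interval `J`,
that stays in `U` and meets `M` lies in `M` (forward and backward in time). -/
def LocallyInvariant (F : E → E) (U M : Set E) : Prop :=
  ∀ (J : Set ℝ) (γ : ℝ → E), J.OrdConnected →
    (∀ t ∈ J, HasDerivWithinAt γ (F (γ t)) J t) → (∀ t ∈ J, γ t ∈ U) →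
    (∃ t ∈ J, γ t ∈ M) → ∀ t ∈ J, γ t ∈ M

/-- The center subspace of a real endomorphism: the real vectors in the sum of the generalized
eigenspaces of the complexification for the eigenvalues with zero real part. -/
noncomputable def centerSubspace (A : E →ₗ[ℝ] E) : Submodule ℝ E :=
  Submodule.comap (TensorProduct.mk ℝ ℂ E 1)
    (Submodule.restrictScalars ℝ
      (⨆ (l : ℂ) (_ : l.re = 0), Module.End.maxGenEigenspace (A.baseChange ℂ) l))

/-- Near `z`, the set `M` is the part in `U` of a smooth (`C^∞`) embedded submanifold, the zero set
of a submersion `Φ`, whose tangent space at `z` is `T`. -/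
def IsSubmanifoldAt (U M : Set E) (z : E) (T : Submodule ℝ E) : Prop :=
  ∃ (m : ℕ) (V : Set E) (Φ : E → EuclideanSpace ℝ (Fin m)),
    IsOpen V ∧ z ∈ V ∧ ContDiffOn ℝ ∞ Φ V ∧ Function.Surjective (fderiv ℝ Φ z) ∧
    M ∩ V = {w | w ∈ U ∩ V ∧ Φ w = 0} ∧
    LinearMap.ker (fderiv ℝ Φ z : E →ₗ[ℝ] EuclideanSpace ℝ (Fin m)) = T

/-- `M` is a smooth center manifold, within `U`, of the equilibrium `p` of `z' = F z`: a locally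
invariant smooth submanifold through `p`, whose dimension is that of the center subspace of the
linearization at `p`, and which is tangent to the center subspace at `p`. -/
structure IsCenterManifold (F : E → E) (U M : Set E) (p : E) : Prop where
  equilibrium : F p = 0
  mem : p ∈ M
  subset : M ⊆ U
  locallyInvariant : LocallyInvariant F U M
  submanifold : ∀ z ∈ M, ∃ T : Submodule ℝ E,
    Module.finrank ℝ T = Module.finrank ℝ (centerSubspace (fderiv ℝ F p : E →ₗ[ℝ] E)) ∧
    IsSubmanifoldAt U M z T
  tangent : IsSubmanifoldAt U M p (centerSubspace (fderiv ℝ F p : E →ₗ[ℝ] E))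

end General

/-! ### The flat model, its extension and its blowup

`expNegInvGlue y` is `exp (-1/y)` for `0 < y` and `0` for `y ≤ 0`. -/

/-- The flat model `x' = ε μ e^{-1/y}`, `y' = y² (x - e^{-1/y})` for the point `(x, y)`. -/
noncomputable def flatField (μ ε : ℝ) (p : ℝ × ℝ) : ℝ × ℝ :=
  (ε * μ * expNegInvGlue p.2, p.2 ^ 2 * (p.1 - expNegInvGlue p.2))

/-- The extended system on points `(x, y, q, ε)`, where `q` replaces `e^{-1/y}`. -/
def extendedField (μ : ℝ) : ℝ × ℝ × ℝ × ℝ → ℝ × ℝ × ℝ × ℝ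
  | (x, y, q, ε) => (ε * μ * q, y ^ 2 * (x - q), q * (x - q), 0)

/-- The chart `κ₁` of the blowup, from `(r₁, x₁, y, ε₁)` to `(x, y, q, ε)`:
`x = r₁ x₁`, `q = r₁`, `ε = r₁ ε₁`. -/
def kappa : ℝ × ℝ × ℝ × ℝ → ℝ × ℝ × ℝ × ℝ
  | (r, x, y, e) => (r * x, y, r, r * e)

/-- The desingularized vector field in the chart `κ₁`, on points `(r₁, x₁, y, ε₁)`. -/
def chartField (μ : ℝ) : ℝ × ℝ × ℝ × ℝ → ℝ × ℝ × ℝ × ℝ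
  | (r, x, y, e) => (r * (x - 1), (1 - x) * x + e * μ, y ^ 2 * (x - 1), (1 - x) * e)

/-- On the set `q = e^{-1/y}`, `y > 0`, the extended system is the flat model together with the
derivative of `q` along it. -/
theorem extendedField_eq_flatField (μ ε x y : ℝ) (hy : 0 < y) :
    extendedField μ (x, y, expNegInvGlue y, ε) =
      ((flatField μ ε (x, y)).1, (flatField μ ε (x, y)).2,
        deriv expNegInvGlue y * (flatField μ ε (x, y)).2, 0) := by
  have h1 : expNegInvGlue y = Real.exp (-y⁻¹) := by simp [expNegInvGlue, hy]
  have h2 : HasDerivAt expNegInvGlue (Real.exp (-y⁻¹) * (y ^ 2)⁻¹) y := by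
    have h := ((hasDerivAt_inv hy.ne').neg).exp
    simp only [Pi.neg_apply, neg_neg] at h
    refine h.congr_of_eventuallyEq ?_
    filter_upwards [lt_mem_nhds hy] with t ht
    simp [expNegInvGlue, ht]
  rw [h2.deriv]
  have hy' := hy.ne'
  simp only [extendedField, flatField, h1, Prod.mk.injEq, true_and, and_true]
  field_simp

/-- `chartField` is the pull-back of `extendedField` under `κ₁`, divided by `r₁`. -/
theorem kappa_chartField (μ : ℝ) (z : ℝ × ℝ × ℝ × ℝ) :
    fderiv ℝ kappa z (z.1 • chartField μ z) = extendedField μ (kappa z) := by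
  obtain ⟨r, x, y, e⟩ := z
  have h1 := hasFDerivAt_fst (𝕜 := ℝ) (p := ((r, x, y, e) : ℝ × ℝ × ℝ × ℝ))
  have h2 := hasFDerivAt_snd (𝕜 := ℝ) (p := ((r, x, y, e) : ℝ × ℝ × ℝ × ℝ))
  have h : HasFDerivAt kappa _ ((r, x, y, e) : ℝ × ℝ × ℝ × ℝ) :=
    (h1.mul h2.fst).prodMk (h2.snd.fst.prodMk (h1.prodMk (h1.mul h2.snd.snd)))
  rw [h.fderiv]
  simp only [chartField, extendedField, kappa, Prod.smul_mk, smul_eq_mul,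
    ContinuousLinearMap.prod_apply, _root_.add_apply, _root_.smul_apply,
    ContinuousLinearMap.comp_apply, ContinuousLinearMap.coe_fst', ContinuousLinearMap.coe_snd',
    Prod.mk.injEq]
  refine ⟨?_, ?_, ?_, ?_⟩ <;> ring

/-- The vector field that `chartField μ` induces on the invariant plane `r₁ = y = 0`, in the
coordinates `(x₁, ε₁)`. -/
def planeField (μ : ℝ) (p : ℝ × ℝ) : ℝ × ℝ :=
  ((chartField μ (0, p.1, 0, p.2)).2.1, (chartField μ (0, p.1, 0, p.2)).2.2.2)

/-! ### The sets of the statement -/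

/-- `ρ(δ) = e^{-1/δ}`. -/
noncomputable def rho (δ : ℝ) : ℝ := expNegInvGlue δ

/-- The box `U₁` in the chart `κ₁`. -/
def box (δ ν ξ : ℝ) : Set (ℝ × ℝ × ℝ × ℝ) :=
  {z | z.1 ∈ Icc 0 (rho δ) ∧ z.2.1 ∈ Icc 0 ξ⁻¹ ∧ z.2.2.1 ∈ Icc 0 δ ∧ z.2.2.2 ∈ Icc 0 ν}

/-- The graph `x₁ = 1 + ε₁ μ (1 + h(r₁, y, ε₁))` over all `(r₁, y, ε₁)` in
`[0, ρ(δ)] × [0, δ] × [0, ν]`. -/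
def graphM (μ δ ν : ℝ) (h : ℝ × ℝ × ℝ → ℝ) : Set (ℝ × ℝ × ℝ × ℝ) :=
  {z | z.1 ∈ Icc 0 (rho δ) ∧ z.2.2.1 ∈ Icc 0 δ ∧ z.2.2.2 ∈ Icc 0 ν ∧
    z.2.1 = 1 + z.2.2.2 * μ * (1 + h (z.1, z.2.2.1, z.2.2.2))}

/-- The critical manifold `S_{a,1}`: `x₁ = 1`, `ε₁ = 0`. -/
def critManifold : Set (ℝ × ℝ × ℝ × ℝ) := {z | z.2.1 = 1 ∧ z.2.2.2 = 0}

/-- The part of a set `M` in the plane `r₁ = y = 0`. -/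
def sliceC (M : Set (ℝ × ℝ × ℝ × ℝ)) : Set (ℝ × ℝ × ℝ × ℝ) :=
  {z | z ∈ M ∧ z.1 = 0 ∧ z.2.2.1 = 0}

/-- `C`, a manifold whose boundary is its part in `ε₁ = ν`, is overflowing invariant for
`z' = F z`: solutions from `C` exist and stay in `C` for all negative times, and `F` points
strictly outward on the boundary. -/
def IsOverflowing (F : ℝ × ℝ × ℝ × ℝ → ℝ × ℝ × ℝ × ℝ) (C : Set (ℝ × ℝ × ℝ × ℝ)) (ν : ℝ) : Prop :=
  (∀ z ∈ C, ∃ γ : ℝ → ℝ × ℝ × ℝ × ℝ, γ 0 = z ∧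
    ∀ t ≤ 0, γ t ∈ C ∧ HasDerivWithinAt γ (F (γ t)) (Iic 0) t) ∧
  ∀ z ∈ C, z.2.2.2 = ν → 0 < (F z).2.2.2

/-- Inflowing invariant: overflowing invariant after reversal of time. -/
def IsInflowing (F : ℝ × ℝ × ℝ × ℝ → ℝ × ℝ × ℝ × ℝ) (C : Set (ℝ × ℝ × ℝ × ℝ)) (ν : ℝ) : Prop :=
  IsOverflowing (fun z => -F z) C ν

/-- The graph of `x = X(y)` over `a ≤ y ≤ b`, in the `(x, y)`-plane. -/
def planarGraph (X : ℝ → ℝ) (a b : ℝ) : Set (ℝ × ℝ) := {p | p.2 ∈ Icc a b ∧ p.1 = X p.2}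

/-- The strip `a ≤ y ≤ b` in the `(x, y)`-plane. -/
def strip (a b : ℝ) : Set (ℝ × ℝ) := {p | p.2 ∈ Icc a b}

/-- The family `Y ε`, `0 < ε ≪ 1`, is a slow manifold `S_{a,ε}` of the flat model over the compact
piece `a ≤ y ≤ b` of the critical manifold `x = e^{-1/y}`: a family of locally invariant `C¹` graphs
that are `O(ε)`-close to the critical manifold. -/
def IsSlowManifold (μ a b : ℝ) (Y : ℝ → ℝ → ℝ) : Prop :=
  ∃ ε₀ K : ℝ, 0 < ε₀ ∧ ∀ ε ∈ Ioo 0 ε₀,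
    ContDiffOn ℝ 1 (Y ε) (Icc a b) ∧
    LocallyInvariant (flatField μ ε) (strip a b) (planarGraph (Y ε) a b) ∧
    ∀ y ∈ Icc a b, |Y ε y - expNegInvGlue y| ≤ K * ε

/-- The set `M ∩ Q₁ ∩ E₁`, where `Q₁` is `r₁ = e^{-1/y}` and `E₁` is `r₁ ε₁ = ε`, blown down to the
`(x, y)`-plane by `κ₁`. -/
def blowDown (M : Set (ℝ × ℝ × ℝ × ℝ)) (ε : ℝ) : Set (ℝ × ℝ) :=
  (fun z => ((kappa z).1, (kappa z).2.1)) ''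
    {z | z ∈ M ∧ z.1 = expNegInvGlue z.2.2.1 ∧ z.1 * z.2.2.2 = ε}

/-- The height `y = 1 / ln (ν / ε)`, i.e. `e^{-1/y} = ε / ν`. -/
noncomputable def yEnd (ν ε : ℝ) : ℝ := 1 / Real.log (ν / ε)

end FlatSlow

/-! The center manifold is explicit: `h = 0` works. Along the chart field, `φ = x₁ - μ ε₁` satisfies
`φ' = -x₁ (φ - 1)`, so the hyperplane `φ = 1`, that is `x₁ = 1 + μ ε₁`, is exactly invariant.
Multiplying by `r₁ = e^{-1/y}` gives the slow manifold `X(ε, y) = e^{-1/y} + ε μ`, and `W = x -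
e^{-1/y} - ε μ` satisfies `W' = -e^{-1/y} W` along the flat model. Local invariance in all three
settings is therefore uniqueness for a scalar linear equation (`locallyInvariant_of_linear`).

The linearization `A` at each equilibrium satisfies `A³ = -A²`, so its only possible eigenvalues are
`0` and `-1`, and the center subspace is `ker A² = ker φ`, the tangent space of the hyperplane
(`centerSubspace_eq_ker`, `isCenterManifold_affine`). On `C₁` the flow reduces to `ε₁' = -μ ε₁²`,
which is solved explicitly.

The one analytic estimate is the comparison with another slow manifold `Y`. Invariance gives `U
dW/dy = -(e^{-1/y} / y²) W` on its graph, with `U = Y - e^{-1/y} = O(ε)`. Small `U` makes `W`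
contract at a rate of order `1/ε` in `y` (`abs_le_exp_mul_of_mul_deriv`). -/

namespace FlatSlow

/-! ### Uniqueness for scalar linear equations -/

section LinearODE

variable {f a : ℝ → ℝ} {J : Set ℝ} {L t₀ : ℝ}

theorem eq_zero_of_hasDerivWithinAt_mul_of_le (hJ : J.OrdConnected)
    (hf : ∀ t ∈ J, HasDerivWithinAt f (a t * f t) J t) (ha : ∀ t ∈ J, |a t| ≤ L)
    (ht₀ : t₀ ∈ J) (h0 : f t₀ = 0) {t : ℝ} (ht : t ∈ J) (h : t₀ ≤ t) : f t = 0 := by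
  have hsub : Icc t₀ t ⊆ J := hJ.out ht₀ ht
  refine eq_zero_of_abs_deriv_le_mul_abs_self_of_eq_zero_right (K := L)
    (f' := fun s => a s * f s)
    (fun s hs => ((hf s (hsub hs)).mono hsub).continuousWithinAt) (fun s hs => ?_) h0
    (fun s hs => ?_) t ⟨h, le_rfl⟩
  · exact ((hf s (hsub (Ico_subset_Icc_self hs))).mono hsub).mono_of_mem_nhdsWithin
      (Icc_mem_nhdsGE_of_mem hs)
  · rw [norm_mul]
    exact mul_le_mul_of_nonneg_right (ha s (hsub (Ico_subset_Icc_self hs))) (norm_nonneg _)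

/-- A solution of a scalar linear equation with bounded coefficient that vanishes once vanishes
everywhere. -/
theorem eq_zero_of_hasDerivWithinAt_mul (hJ : J.OrdConnected)
    (hf : ∀ t ∈ J, HasDerivWithinAt f (a t * f t) J t) (ha : ∀ t ∈ J, |a t| ≤ L)
    (ht₀ : t₀ ∈ J) (h0 : f t₀ = 0) {t : ℝ} (ht : t ∈ J) : f t = 0 := by
  rcases le_total t₀ t with h | h
  · exact eq_zero_of_hasDerivWithinAt_mul_of_le hJ hf ha ht₀ h0 ht h
  -- Backward in time: `s ↦ f (-s)` solves the linear equation with coefficient `-a (-s)`.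
  · have hJ' : (Neg.neg ⁻¹' J).OrdConnected :=
      ⟨fun x hx y hy z hz => hJ.out hy hx ⟨neg_le_neg hz.2, neg_le_neg hz.1⟩⟩
    have key := eq_zero_of_hasDerivWithinAt_mul_of_le (f := fun s => f (-s))
      (a := fun s => -a (-s)) (L := L) (t₀ := -t₀) (t := -t) hJ' (fun s hs => ?_)
      (fun s hs => by simpa using ha _ hs) (by simpa using ht₀) (by simpa using h0)
      (by simpa using ht) (neg_le_neg h)
    · simpa using key
    · have := (hf (-s) hs).scomp s (hasDerivAt_neg s).hasDerivWithinAt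
        (fun x hx => hx : MapsTo Neg.neg (Neg.neg ⁻¹' J) J)
      exact this.congr_deriv (by simp)

end LinearODE

/-! ### Center subspaces and affine center manifolds -/

section General

variable {E : Type*} [NormedAddCommGroup E] [NormedSpace ℝ E]

/-- On the range of `A²` the map acts as `-1`, so `A - l` acts there as `-1 - l`, which is
invertible when `l` is imaginary. Hence `A²` kills every generalized eigenvector for such `l`;
conversely `ker A²` lies in the generalized eigenspace of `0`. The square is essential: for `y ≠ 0`
the chart linearization has a Jordan block at `0`. -/
theorem centerSubspace_eq_ker (A : E →ₗ[ℝ] E) (hA : ∀ v, A (A (A v)) = -A (A v)) :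
    centerSubspace A = LinearMap.ker (A ∘ₗ A) := by
  set B : Module.End ℂ (ℂ ⊗[ℝ] E) := A.baseChange ℂ with hB
  have hB3 : ∀ w, B (B (B w)) = -B (B w) := by
    intro w
    induction w with
    | zero => simp
    | tmul z v => simp [hB, hA, TensorProduct.tmul_neg]
    | add x y hx hy => simp only [map_add, hx, hy]; abel
  have hsup : (⨆ (l : ℂ) (_ : l.re = 0), Module.End.maxGenEigenspace B l)
      = LinearMap.ker (B ∘ₗ B) := by
    apply le_antisymm
    · refine iSup₂_le fun l hl w hw => ?_
      obtain ⟨k, hk⟩ := (Module.End.mem_maxGenEigenspace _ _ _).1 hw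
      have hpow : ∀ n : ℕ, ((B - l • 1) ^ n) (B (B w)) = (-1 - l) ^ n • B (B w) := by
        intro n
        induction n with
        | zero => simp
        | succ n ih =>
          rw [pow_succ', Module.End.mul_apply, ih, map_smul, pow_succ, mul_smul]
          congr 1
          simp [hB3, sub_smul]
      have hcomm : Commute ((B - l • 1) ^ k) (B * B) := by
        have h1 : Commute (B - l • 1) B :=
          (Commute.refl B).sub_left ((Commute.one_left B).smul_left l)
        exact (h1.mul_right h1).pow_left k
      have h2 : (-1 - l) ^ k • B (B w) = 0 := by
        rw [← hpow]
        have := LinearMap.congr_fun hcomm.eq w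
        simp only [Module.End.mul_apply] at this
        rw [this, hk, map_zero, map_zero]
      have hne : (-1 - l) ^ k ≠ 0 := by
        apply pow_ne_zero
        intro h
        have := congrArg Complex.re h
        simp [hl] at this
      simpa [hne] using h2
    · refine le_trans (fun w hw => ?_) (le_iSup₂ (f := fun (l : ℂ) (_ : l.re = 0) =>
        Module.End.maxGenEigenspace B l) 0 Complex.zero_re)
      refine (Module.End.mem_maxGenEigenspace _ _ _).2 ⟨2, ?_⟩
      simpa [pow_two] using hw
  ext v
  -- Injectivity of `v ↦ 1 ⊗ v` brings the kernel back from the complexification.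
  have hinj := Module.FaithfullyFlat.tensorProduct_mk_injective (A := ℝ) (B := ℂ) E
  unfold centerSubspace
  rw [← hB, hsup]
  have h3 : B (B (1 ⊗ₜ[ℝ] v)) = TensorProduct.mk ℝ ℂ E 1 (A (A v)) := by simp [hB]
  simp only [Submodule.mem_comap, TensorProduct.mk_apply, Submodule.restrictScalars_mem,
    LinearMap.mem_ker, LinearMap.comp_apply, h3]
  exact map_eq_zero_iff _ hinj

/-- Along a solution in `U`, `g` obeys a scalar linear equation with bounded coefficient, so one
zero forces it to vanish throughout. -/
theorem locallyInvariant_of_linear {F : E → E} {U M : Set E} {g : E → ℝ} {g' : E → E →L[ℝ] ℝ}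
    {a : E → ℝ} {L : ℝ} (hM : M = {z | z ∈ U ∧ g z = 0})
    (hg : ∀ z ∈ U, HasFDerivAt g (g' z) z) (hF : ∀ z ∈ U, g' z (F z) = a z * g z)
    (ha : ∀ z ∈ U, |a z| ≤ L) : LocallyInvariant F U M := by
  rintro J γ hJ hγ hU ⟨t₀, ht₀, hM₀⟩ t ht
  rw [hM] at hM₀ ⊢
  refine ⟨hU t ht, eq_zero_of_hasDerivWithinAt_mul (f := fun s => g (γ s))
    (a := fun s => a (γ s)) hJ (fun s hs => ?_) (fun s hs => ha _ (hU s hs)) ht₀ hM₀.2 ht⟩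
  rw [← hF _ (hU s hs)]
  exact (hg _ (hU s hs)).comp_hasDerivWithinAt s (hγ s hs)

theorem isSubmanifoldAt_affine {U M : Set E} {φ : E →L[ℝ] ℝ} {c : ℝ} (hφ : φ ≠ 0)
    (hM : M = {z | z ∈ U ∧ φ z - c = 0}) (z : E) :
    IsSubmanifoldAt U M z (LinearMap.ker (φ : E →ₗ[ℝ] ℝ)) := by
  -- Identifies `ℝ` with the one-dimensional Euclidean target; `φ - c` is then a global defining
  -- function with constant differential.
  let e : ℝ →L[ℝ] EuclideanSpace ℝ (Fin 1) :=
    (ContinuousLinearMap.id ℝ ℝ).smulRight (EuclideanSpace.single 0 1)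
  have he : ∀ s, e s = 0 ↔ s = 0 := fun s => by
    simp [e]
  have hd : HasFDerivAt (fun w => e (φ w - c)) (e ∘L φ) z :=
    e.hasFDerivAt.comp z (φ.hasFDerivAt.sub_const c)
  refine ⟨1, univ, fun w => e (φ w - c), isOpen_univ, mem_univ _, ?_, ?_, ?_, ?_⟩
  · exact (e.contDiff.comp (φ.contDiff.sub contDiff_const)).contDiffOn
  · rw [hd.fderiv]
    intro v
    obtain ⟨w, hw⟩ : ∃ w, φ w ≠ 0 := by
      by_contra! h
      exact hφ (ContinuousLinearMap.ext h)
    refine ⟨(v 0 / φ w) • w, ?_⟩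
    ext i
    fin_cases i
    simp [e, hw]
  · ext w
    simp only [mem_inter_iff, mem_univ, and_true, mem_ofPred_eq, hM, he]
  · rw [hd.fderiv]
    ext w
    simp [he]

/-- The zero set of an affine function `φ - c` that satisfies a linear equation along the flow is a
center manifold, when the linearization `A` satisfies `A³ = -A²` and `ker A² = ker φ`. -/
theorem isCenterManifold_affine {F : E → E} {U M : Set E} {p : E} {A : E →L[ℝ] E}
    {φ : E →L[ℝ] ℝ} {c L : ℝ} {a : E → ℝ} (hφ : φ ≠ 0)
    (hM : M = {z | z ∈ U ∧ φ z - c = 0}) (hFp : F p = 0) (hp : p ∈ M)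
    (hA : HasFDerivAt F A p) (hA3 : ∀ v, A (A (A v)) = -A (A v))
    (hker : ∀ v, A (A v) = 0 ↔ φ v = 0) (hF : ∀ z ∈ U, φ (F z) = a z * (φ z - c))
    (ha : ∀ z ∈ U, |a z| ≤ L) : IsCenterManifold F U M p := by
  have hc : centerSubspace (fderiv ℝ F p : E →ₗ[ℝ] E) = LinearMap.ker (φ : E →ₗ[ℝ] ℝ) := by
    rw [hA.fderiv, centerSubspace_eq_ker _ hA3]
    ext v
    simpa using hker v
  refine ⟨hFp, hp, fun z hz => ?_, ?_, fun z _ => ⟨_, rfl, ?_⟩, ?_⟩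
  · rw [hM] at hz
    exact hz.1
  · exact locallyInvariant_of_linear hM (fun z _ => φ.hasFDerivAt.sub_const c) hF ha
  · rw [hc]
    exact isSubmanifoldAt_affine hφ hM z
  · rw [hc]
    exact isSubmanifoldAt_affine hφ hM p

end General

/-! ### The center manifold and its slice in the blowup chart -/

section Chart

/-- The linear functional `x₁ - μ ε₁`; the center manifold is its level set `1`. -/
noncomputable def chartFunctional (μ : ℝ) : ℝ × ℝ × ℝ × ℝ →L[ℝ] ℝ :=
  LinearMap.toContinuousLinearMap
    { toFun := fun z => z.2.1 - μ * z.2.2.2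
      map_add' := fun z w => by simp only [Prod.snd_add, Prod.fst_add]; ring
      map_smul' := fun s z => by
        simp only [Prod.smul_snd, Prod.smul_fst, smul_eq_mul, RingHom.id_apply]; ring }

@[simp] theorem chartFunctional_apply (μ : ℝ) (z : ℝ × ℝ × ℝ × ℝ) :
    chartFunctional μ z = z.2.1 - μ * z.2.2.2 := rfl

/-- The linearization of the chart field at `(0, 1, y, 0)`. -/
noncomputable def chartLinearization (μ y : ℝ) : ℝ × ℝ × ℝ × ℝ →L[ℝ] ℝ × ℝ × ℝ × ℝ :=
  LinearMap.toContinuousLinearMap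
    { toFun := fun v => (0, -v.2.1 + μ * v.2.2.2, y ^ 2 * v.2.1, 0)
      map_add' := fun z w => by
        simp only [Prod.snd_add, Prod.fst_add, Prod.mk_add_mk, Prod.mk.injEq]
        refine ⟨?_, ?_, ?_, ?_⟩ <;> ring
      map_smul' := fun s z => by
        simp only [Prod.smul_snd, Prod.smul_fst, smul_eq_mul, RingHom.id_apply, Prod.smul_mk,
          Prod.mk.injEq]
        refine ⟨?_, ?_, ?_, ?_⟩ <;> ring }

@[simp] theorem chartLinearization_apply (μ y : ℝ) (v : ℝ × ℝ × ℝ × ℝ) :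
    chartLinearization μ y v = (0, -v.2.1 + μ * v.2.2.2, y ^ 2 * v.2.1, 0) := rfl

theorem hasFDerivAt_chartField (μ y : ℝ) :
    HasFDerivAt (chartField μ) (chartLinearization μ y) (0, 1, y, 0) := by
  have hr := hasFDerivAt_fst (𝕜 := ℝ) (p := ((0, 1, y, 0) : ℝ × ℝ × ℝ × ℝ))
  have hs := hasFDerivAt_snd (𝕜 := ℝ) (p := ((0, 1, y, 0) : ℝ × ℝ × ℝ × ℝ))
  have h : HasFDerivAt (chartField μ) _ ((0, 1, y, 0) : ℝ × ℝ × ℝ × ℝ) :=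
    (hr.mul (hs.fst.sub_const 1)).prodMk
      ((((hs.fst.const_sub 1).mul hs.fst).add (hs.snd.snd.mul_const μ)).prodMk
        (((hs.snd.fst.pow 2).mul (hs.fst.sub_const 1)).prodMk
          ((hs.fst.const_sub 1).mul hs.snd.snd)))
  refine h.congr_fderiv (ContinuousLinearMap.ext fun v => ?_)
  simp [mul_comm]

/-- The box constraints are automatic on the graph with `h = 0` when `ν` and `ξ` are small. -/
theorem mem_Icc_of_small {μ ν ξ e : ℝ} (hν : ν ≤ 1 / (1 + |μ|)) (hξ0 : 0 < ξ) (hξ : ξ ≤ 1 / 2)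
    (he : e ∈ Icc 0 ν) : 1 + e * μ ∈ Icc 0 ξ⁻¹ := by
  have hpos : 0 < 1 + |μ| := by positivity
  -- The bound on `ν` gives `|e μ| ≤ 1`, hence `0 ≤ 1 + e μ ≤ 2`, and `ξ ≤ 1/2` gives `2 ≤ ξ⁻¹`.
  have h1 : e * (1 + |μ|) ≤ 1 := by
    have := (le_div_iff₀ hpos).1 (he.2.trans hν)
    exact this
  have h2 : |e * μ| ≤ 1 := by
    rw [abs_mul, abs_of_nonneg he.1]
    nlinarith [he.1]
  have h3 : (2 : ℝ) ≤ ξ⁻¹ := by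
    rw [le_inv_comm₀ two_pos hξ0]
    linarith
  have := abs_le.1 h2
  constructor <;> linarith

variable {μ δ ν ξ : ℝ}

theorem mem_graphM_zero {z : ℝ × ℝ × ℝ × ℝ} : z ∈ graphM μ δ ν (fun _ => 0) ↔
    z.1 ∈ Icc 0 (rho δ) ∧ z.2.2.1 ∈ Icc 0 δ ∧ z.2.2.2 ∈ Icc 0 ν ∧ z.2.1 = 1 + z.2.2.2 * μ := by
  simp [graphM]

theorem graphM_zero_eq (hν : ν ≤ 1 / (1 + |μ|)) (hξ0 : 0 < ξ) (hξ : ξ ≤ 1 / 2) :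
    graphM μ δ ν (fun _ => 0) = {z | z ∈ box δ ν ξ ∧ chartFunctional μ z - 1 = 0} := by
  ext z
  rw [mem_graphM_zero]
  constructor
  · rintro ⟨h1, h2, h3, h4⟩
    refine ⟨⟨h1, ?_, h2, h3⟩, ?_⟩
    · rw [h4]
      exact mem_Icc_of_small hν hξ0 hξ h3
    · rw [chartFunctional_apply, h4]
      ring
  · rintro ⟨⟨h1, -, h2, h3⟩, h4⟩
    refine ⟨h1, h2, h3, ?_⟩
    rw [chartFunctional_apply] at h4
    linarith

theorem rho_nonneg (δ : ℝ) : 0 ≤ rho δ := expNegInvGlue.nonneg δ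

/-- Rests on `φ (F z) = -x₁ (φ z - 1)`, whose coefficient is at most `ξ⁻¹` in absolute value on the
box, and on `A² v = φ(v) (0, 1, -y², 0)`, which gives `ker A² = ker φ`. -/
theorem isCenterManifold_graphM (hν0 : 0 ≤ ν) (hν : ν ≤ 1 / (1 + |μ|)) (hξ0 : 0 < ξ)
    (hξ : ξ ≤ 1 / 2) {y : ℝ} (hy : y ∈ Icc 0 δ) :
    IsCenterManifold (chartField μ) (box δ ν ξ) (graphM μ δ ν (fun _ => 0)) (0, 1, y, 0) := by
  refine isCenterManifold_affine (φ := chartFunctional μ) (c := 1) (L := ξ⁻¹)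
    (a := fun z => -z.2.1) ?_ (graphM_zero_eq hν hξ0 hξ) ?_ ?_ (hasFDerivAt_chartField μ y)
    ?_ ?_ ?_ ?_
  · intro h
    simpa using DFunLike.congr_fun h (0, 1, 0, 0)
  · simp [chartField]
  · rw [mem_graphM_zero]
    exact ⟨⟨le_rfl, rho_nonneg δ⟩, hy, ⟨le_rfl, hν0⟩, by simp⟩
  · intro v
    simp
    ring
  · intro v
    simp only [chartLinearization_apply, chartFunctional_apply, Prod.ext_iff, Prod.fst_zero,
      Prod.snd_zero]
    constructor
    · rintro ⟨-, h, -⟩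
      linarith
    · intro h
      have h' : -v.2.1 + μ * v.2.2.2 = 0 := by linarith
      simp [h']
  · rintro ⟨r, x, y, e⟩ -
    simp only [chartFunctional_apply, chartField]
    ring
  · rintro z ⟨-, h, -⟩
    rw [abs_neg, abs_of_nonneg h.1]
    exact h.2

/-- The linear functional `x₁ - μ ε₁` on the plane `r₁ = y = 0`. -/
noncomputable def planeFunctional (μ : ℝ) : ℝ × ℝ →L[ℝ] ℝ :=
  LinearMap.toContinuousLinearMap
    { toFun := fun z => z.1 - μ * z.2
      map_add' := fun z w => by simp only [Prod.snd_add, Prod.fst_add]; ring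
      map_smul' := fun s z => by
        simp only [Prod.smul_snd, Prod.smul_fst, smul_eq_mul, RingHom.id_apply]; ring }

@[simp] theorem planeFunctional_apply (μ : ℝ) (z : ℝ × ℝ) :
    planeFunctional μ z = z.1 - μ * z.2 := rfl

/-- The linearization of the planar field at `(1, 0)`. -/
noncomputable def planeLinearization (μ : ℝ) : ℝ × ℝ →L[ℝ] ℝ × ℝ :=
  LinearMap.toContinuousLinearMap
    { toFun := fun v => (-v.1 + μ * v.2, 0)
      map_add' := fun z w => by
        simp only [Prod.snd_add, Prod.fst_add, Prod.mk_add_mk, Prod.mk.injEq]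
        constructor <;> ring
      map_smul' := fun s z => by
        simp only [Prod.smul_snd, Prod.smul_fst, smul_eq_mul, RingHom.id_apply, Prod.smul_mk,
          Prod.mk.injEq]
        constructor <;> ring }

@[simp] theorem planeLinearization_apply (μ : ℝ) (v : ℝ × ℝ) :
    planeLinearization μ v = (-v.1 + μ * v.2, 0) := rfl

theorem hasFDerivAt_planeField (μ : ℝ) :
    HasFDerivAt (planeField μ) (planeLinearization μ) (1, 0) := by
  have hx := hasFDerivAt_fst (𝕜 := ℝ) (p := ((1, 0) : ℝ × ℝ))
  have he := hasFDerivAt_snd (𝕜 := ℝ) (p := ((1, 0) : ℝ × ℝ))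
  have h : HasFDerivAt (planeField μ) _ ((1, 0) : ℝ × ℝ) :=
    (((hx.const_sub 1).mul hx).add (he.mul_const μ)).prodMk ((hx.const_sub 1).mul he)
  refine h.congr_fderiv (ContinuousLinearMap.ext fun v => ?_)
  simp

theorem isCenterManifold_sliceC (hδ : 0 ≤ δ) (hν0 : 0 ≤ ν) (hν : ν ≤ 1 / (1 + |μ|)) (hξ0 : 0 < ξ)
    (hξ : ξ ≤ 1 / 2) :
    IsCenterManifold (planeField μ) (Icc 0 ξ⁻¹ ×ˢ Icc 0 ν)
      {p | (0, p.1, 0, p.2) ∈ sliceC (graphM μ δ ν (fun _ => 0))} (1, 0) := by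
  refine isCenterManifold_affine (φ := planeFunctional μ) (c := 1) (L := ξ⁻¹)
    (a := fun z => -z.1) ?_ ?_ ?_ ?_ (hasFDerivAt_planeField μ) ?_ ?_ ?_ ?_
  · intro h
    simpa using DFunLike.congr_fun h (1, 0)
  · ext ⟨x, e⟩
    simp only [sliceC, mem_ofPred_eq, mem_graphM_zero, mem_prod, planeFunctional_apply]
    constructor
    · rintro ⟨⟨-, -, he, rfl⟩, -⟩
      exact ⟨⟨mem_Icc_of_small hν hξ0 hξ he, he⟩, by ring⟩
    · rintro ⟨⟨-, he⟩, h⟩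
      exact ⟨⟨⟨le_rfl, rho_nonneg δ⟩, ⟨le_rfl, hδ⟩, he, by linarith⟩, trivial, trivial⟩
  · simp [planeField, chartField]
  · simp only [sliceC, mem_ofPred_eq, mem_graphM_zero]
    exact ⟨⟨⟨le_rfl, rho_nonneg δ⟩, ⟨le_rfl, hδ⟩, ⟨le_rfl, hν0⟩, by simp⟩, trivial, trivial⟩
  · intro v
    simp
  · intro v
    simp only [planeLinearization_apply, planeFunctional_apply, Prod.ext_iff, Prod.fst_zero,
      Prod.snd_zero]
    constructor
    · rintro ⟨h, -⟩
      linarith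
    · intro h
      exact ⟨by linarith, trivial⟩
  · rintro ⟨x, e⟩ -
    simp only [planeFunctional_apply, planeField, chartField]
    ring
  · rintro z ⟨h, -⟩
    rw [abs_neg, abs_of_nonneg h.1]
    exact h.2

theorem graphM_inter_eq_critManifold (hξ0 : 0 < ξ) (hξ : ξ ≤ 1 / 2) :
    {z | z ∈ graphM μ δ ν (fun _ => 0) ∧ z.2.2.2 = 0} = critManifold ∩ box δ ν ξ := by
  have hξ1 : (1 : ℝ) ≤ ξ⁻¹ := by
    rw [le_inv_comm₀ one_pos hξ0]
    linarith
  ext ⟨r, x, y, e⟩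
  simp only [mem_ofPred_eq, mem_graphM_zero, critManifold, box, mem_inter_iff]
  constructor
  · rintro ⟨⟨h1, h2, h3, h4⟩, rfl⟩
    have hx : x = 1 := by simpa using h4
    subst hx
    exact ⟨⟨rfl, rfl⟩, h1, ⟨zero_le_one, hξ1⟩, h2, h3⟩
  · rintro ⟨⟨rfl, rfl⟩, h1, h2, h3, h4⟩
    exact ⟨⟨h1, h3, h4, by simp⟩, rfl⟩

theorem chartField_eq_zero_of_mem_critManifold {z : ℝ × ℝ × ℝ × ℝ} (hz : z ∈ critManifold) :
    chartField μ z = 0 := by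
  obtain ⟨r, x, y, e⟩ := z
  obtain ⟨hx, he⟩ := hz
  simp only at hx he
  simp [chartField, hx, he]

theorem chartField_eps_of_mem_sliceC {z : ℝ × ℝ × ℝ × ℝ}
    (hz : z ∈ sliceC (graphM μ δ ν (fun _ => 0))) :
    (chartField μ z).2.2.2 = -μ * z.2.2.2 ^ 2 := by
  obtain ⟨r, x, y, e⟩ := z
  have h := (mem_graphM_zero.1 hz.1).2.2.2
  simp only at h
  simp only [chartField, h]
  ring

/-- The solution `ε₁ = e / (1 - m e t)` of the reduced flow on `C₁`, run in the direction `s`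
of time in which it decays towards the past. -/
theorem exists_solution_sliceC {s m : ℝ} (hs : s * μ = -m) (hm : 0 ≤ m)
    {z : ℝ × ℝ × ℝ × ℝ} (hz : z ∈ sliceC (graphM μ δ ν (fun _ => 0))) :
    ∃ γ : ℝ → ℝ × ℝ × ℝ × ℝ, γ 0 = z ∧ ∀ t ≤ 0, γ t ∈ sliceC (graphM μ δ ν (fun _ => 0)) ∧
      HasDerivWithinAt γ (s • chartField μ (γ t)) (Iic 0) t := by
  obtain ⟨r, x, y, e⟩ := z
  obtain ⟨hz, hr, hy⟩ := hz
  rw [mem_graphM_zero] at hz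
  simp only at hz hr hy
  obtain ⟨h1, h2, h3, h4⟩ := hz
  subst hr hy h4
  -- A denominator at least `1` excludes blow-up in the past and keeps `ε₁` in `[0, e]`, hence in
  -- `[0, ν]`.
  have hden : ∀ t ≤ 0, 1 ≤ 1 - m * e * t := fun t ht => by
    have := mul_nonneg (mul_nonneg hm h3.1) (neg_nonneg.2 ht)
    linarith
  refine ⟨fun t => (0, 1 + e / (1 - m * e * t) * μ, 0, e / (1 - m * e * t)), by simp,
    fun t ht => ⟨⟨mem_graphM_zero.2 ⟨h1, h2, ⟨?_, ?_⟩, rfl⟩, rfl, rfl⟩, ?_⟩⟩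
  · exact div_nonneg h3.1 (zero_le_one.trans (hden t ht))
  · exact (div_le_self h3.1 (hden t ht)).trans h3.2
  · have hne : 1 - m * e * t ≠ 0 := (zero_lt_one.trans_le (hden t ht)).ne'
    have hd : HasDerivAt (fun t => e / (1 - m * e * t)) (m * (e / (1 - m * e * t)) ^ 2) t := by
      have := (hasDerivAt_const t e).div
        (((hasDerivAt_id t).const_mul (m * e)).const_sub 1) hne
      refine this.congr_deriv ?_
      simp only [id]
      field_simp
      ring
    have := (hasDerivAt_const t (0 : ℝ)).prodMk (((hd.mul_const μ).const_add 1).prodMk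
      ((hasDerivAt_const t (0 : ℝ)).prodMk hd))
    refine (this.congr_deriv ?_).hasDerivWithinAt
    simp only [chartField, Prod.smul_mk, smul_eq_mul, Prod.mk.injEq]
    have hm' : m = -(s * μ) := by linarith
    generalize e / (1 - m * e * t) = w
    subst hm'
    refine ⟨?_, ?_, ?_, ?_⟩ <;> ring

theorem isOverflowing_sliceC (hν0 : 0 < ν) (hμ : μ < 0) :
    IsOverflowing (chartField μ) (sliceC (graphM μ δ ν (fun _ => 0))) ν := by
  refine ⟨fun z hz => ?_, fun z hz hzν => ?_⟩
  · simpa using exists_solution_sliceC (s := 1) (m := -μ) (by ring) (by linarith) hz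
  · rw [chartField_eps_of_mem_sliceC hz, hzν]
    have : 0 < -μ := by linarith
    positivity

theorem isInflowing_sliceC (hν0 : 0 < ν) (hμ : 0 < μ) :
    IsInflowing (chartField μ) (sliceC (graphM μ δ ν (fun _ => 0))) ν := by
  refine ⟨fun z hz => ?_, fun z hz hzν => ?_⟩
  · simpa using exists_solution_sliceC (s := -1) (m := μ) (by ring) hμ.le hz
  · rw [Prod.snd_neg, Prod.snd_neg, Prod.snd_neg, chartField_eps_of_mem_sliceC hz, hzν]
    have : 0 < μ * ν ^ 2 := by positivity
    linarith

end Chart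

/-! ### The flat model: the slow manifold and its exponential uniqueness -/

section Flat

theorem expNegInvGlue_of_pos {y : ℝ} (hy : 0 < y) : expNegInvGlue y = Real.exp (-y⁻¹) := by
  simp [expNegInvGlue, hy]

theorem expNegInvGlue_le_one (y : ℝ) : expNegInvGlue y ≤ 1 := by
  rcases le_or_gt y 0 with hy | hy
  · rw [expNegInvGlue.zero_of_nonpos hy]
    exact zero_le_one
  · rw [expNegInvGlue_of_pos hy, Real.exp_le_one_iff]
    simpa using hy.le

theorem hasDerivAt_expNegInvGlue {y : ℝ} (hy : 0 < y) :
    HasDerivAt expNegInvGlue (expNegInvGlue y / y ^ 2) y := by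
  have h := ((hasDerivAt_inv hy.ne').neg).exp
  simp only [Pi.neg_apply, neg_neg] at h
  rw [expNegInvGlue_of_pos hy, div_eq_mul_inv]
  refine h.congr_of_eventuallyEq ?_
  filter_upwards [lt_mem_nhds hy] with t ht
  exact expNegInvGlue_of_pos ht

/-- With `q = e^{-1/y}` one has `q' = q (x - q)`, so `g = x - q - ε μ` satisfies `g' = -q g`, and `0
≤ q ≤ 1`. -/
theorem locallyInvariant_planarGraph (μ ε : ℝ) {a b : ℝ} (ha : 0 < a) :
    LocallyInvariant (flatField μ ε) (strip a b)
      (planarGraph (fun y => expNegInvGlue y + ε * μ) a b) := by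
  refine locallyInvariant_of_linear (L := 1)
    (g := fun p => p.1 - (expNegInvGlue p.2 + ε * μ))
    (g' := fun p => ContinuousLinearMap.fst ℝ ℝ ℝ -
      (expNegInvGlue p.2 / p.2 ^ 2) • ContinuousLinearMap.snd ℝ ℝ ℝ)
    (a := fun p => -expNegInvGlue p.2) ?_ (fun p hp => ?_) (fun p hp => ?_) (fun p _ => ?_)
  · ext p
    simp [planarGraph, strip, sub_eq_zero]
  · exact hasFDerivAt_fst.sub
      (((hasDerivAt_expNegInvGlue (ha.trans_le hp.1)).comp_hasFDerivAt p
        hasFDerivAt_snd).add_const _)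
  · have hy : p.2 ≠ 0 := (ha.trans_le hp.1).ne'
    simp only [flatField, _root_.sub_apply, ContinuousLinearMap.coe_fst',
      ContinuousLinearMap.coe_snd', _root_.smul_apply, smul_eq_mul]
    field_simp
    ring
  · rw [abs_neg, abs_of_nonneg (expNegInvGlue.nonneg _)]
    exact expNegInvGlue_le_one _

/-- A locally invariant differentiable graph is tangent to the vector field. -/
theorem tangent_of_locallyInvariant {μ ε a b : ℝ} {Y : ℝ → ℝ}
    (hY : LocallyInvariant (flatField μ ε) (strip a b) (planarGraph Y a b)) {y Y' : ℝ}
    (hy : y ∈ Ioo a b) (hd : HasDerivAt Y Y' y) :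
    ε * μ * expNegInvGlue y = Y' * (y ^ 2 * (Y y - expNegInvGlue y)) := by
  have hsm : ContDiffAt ℝ 1 (flatField μ ε) (Y y, y) := by
    have h : ContDiff ℝ 1 fun p : ℝ × ℝ => expNegInvGlue p.2 :=
      (expNegInvGlue.contDiff (n := 1)).comp contDiff_snd
    exact ((contDiff_const.mul h).prodMk
      ((contDiff_snd.pow 2).mul (contDiff_fst.sub h))).contDiffAt
  -- The solution through `(Y y, y)` stays in the strip for a short time, because `y` is interior,
  -- and hence on the graph. Differentiating `x = Y(y)` along it at time `0` gives the identity.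
  obtain ⟨γ, hγ0, s, hs, hγ⟩ :=
    hsm.exists_forall_mem_closedBall_exists_eq_forall_mem_Ioo_hasDerivAt₀ 0
  have hγ00 := hγ 0 ⟨by linarith, by linarith⟩
  rw [hγ0] at hγ00
  have hx : HasDerivAt (fun t => (γ t).1) (ε * μ * expNegInvGlue y) 0 := hγ00.fst
  have hy2 : HasDerivAt (fun t => (γ t).2) (y ^ 2 * (Y y - expNegInvGlue y)) 0 := hγ00.snd
  have hnear : ∀ᶠ t in 𝓝 (0 : ℝ), (γ t).2 ∈ Ioo a b := by
    apply hy2.continuousAt.eventually_mem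
    rw [hγ0]
    exact Ioo_mem_nhds hy.1 hy.2
  obtain ⟨η, hη, hηball⟩ := Metric.eventually_nhds_iff_ball.1 hnear
  have hgraph : ∀ t ∈ Ioo (-min s η) (min s η), γ t ∈ planarGraph Y a b := by
    refine hY _ γ ordConnected_Ioo (fun t ht => (hγ t ?_).hasDerivWithinAt) (fun t ht => ?_)
      ⟨0, ?_, ?_⟩
    · constructor <;> linarith [ht.1, ht.2, min_le_left s η]
    · refine Ioo_subset_Icc_self (hηball t ?_)
      rw [Metric.mem_ball, Real.dist_eq, sub_zero, abs_lt]
      constructor <;> linarith [ht.1, ht.2, min_le_right s η]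
    · simp [hs, hη]
    · rw [hγ0]
      exact ⟨Ioo_subset_Icc_self hy, rfl⟩
  have hd' : HasDerivAt Y Y' (γ 0).2 := by rwa [hγ0]
  have hcomp : HasDerivAt (fun t => Y (γ t).2) (Y' * (y ^ 2 * (Y y - expNegInvGlue y))) 0 :=
    hd'.comp (0 : ℝ) hy2
  refine hx.unique (hcomp.congr_of_eventuallyEq ?_)
  filter_upwards [Ioo_mem_nhds (neg_lt_zero.2 (lt_min hs hη)) (lt_min hs hη)] with t ht
  exact (hgraph t ht).2

/-- Contraction along a scalar equation `U W' = -p W` with `p ≥ m` and `U ≤ L`: if `U > 0` at the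
right end point, then `W` there is exponentially smaller than at the left end point. -/
theorem abs_le_exp_mul_of_mul_deriv {U W W' p : ℝ → ℝ} {α β m L : ℝ} (hαβ : α ≤ β) (hm : 0 < m)
    (hL : 0 < L) (hU : ContinuousOn U (Icc α β)) (hW : ∀ y ∈ Icc α β, HasDerivAt W (W' y) y)
    (heq : ∀ y ∈ Icc α β, U y * W' y = -p y * W y) (hp : ∀ y ∈ Icc α β, m ≤ p y)
    (hUL : ∀ y ∈ Icc α β, U y ≤ L) (hβ : 0 < U β) :
    |W β| ≤ Real.exp (-(m * (β - α) / L)) * |W α| := by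
  -- This rate makes `W² e^{2κy}` nonincreasing wherever `U > 0`: `U (W W' + κ W²) = (κ U - p) W²`,
  -- and `κ U ≤ κ L = m ≤ p`.
  set κ := m / L with hκ
  have hκ0 : 0 < κ := div_pos hm hL
  have hGd : ∀ y ∈ Icc α β, HasDerivAt (fun y => W y ^ 2 * Real.exp (2 * κ * y))
      (2 * (W y * W' y + κ * W y ^ 2) * Real.exp (2 * κ * y)) y := fun y hy => by
    have h1 := ((hW y hy).pow 2).mul (((hasDerivAt_id y).const_mul (2 * κ)).exp)
    refine h1.congr_deriv ?_
    simp only [id, Pi.pow_apply]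
    push_cast
    ring
  have hsign : ∀ y ∈ Icc α β, 0 < U y →
      2 * (W y * W' y + κ * W y ^ 2) * Real.exp (2 * κ * y) ≤ 0 := fun y hy hUy => by
    refine mul_nonpos_of_nonpos_of_nonneg ?_ (Real.exp_pos _).le
    have h1 : U y * (W y * W' y + κ * W y ^ 2) = (κ * U y - p y) * W y ^ 2 := by
      linear_combination W y * heq y hy
    have h2 : κ * U y ≤ p y := by
      have : κ * U y ≤ κ * L := mul_le_mul_of_nonneg_left (hUL y hy) hκ0.le
      have h3 : κ * L = m := by rw [hκ]; field_simp
      linarith [hp y hy]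
    have h4 : U y * (W y * W' y + κ * W y ^ 2) ≤ 0 := by
      rw [h1]
      exact mul_nonpos_of_nonpos_of_nonneg (by linarith) (sq_nonneg _)
    have := nonpos_of_mul_nonpos_right h4 hUy
    linarith
  have hanti : ∀ c ∈ Icc α β, (∀ y ∈ Ioc c β, 0 < U y) →
      W β ^ 2 * Real.exp (2 * κ * β) ≤ W c ^ 2 * Real.exp (2 * κ * c) := fun c hc hpos => by
    have hsub : ∀ y ∈ Icc c β, y ∈ Icc α β := fun y hy => ⟨hc.1.trans hy.1, hy.2⟩
    refine antitoneOn_of_deriv_nonpos (convex_Icc c β)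
      (fun y hy => (hGd y (hsub y hy)).continuousAt.continuousWithinAt)
      (fun y hy => (hGd y (hsub y (interior_subset hy))).differentiableAt.differentiableWithinAt)
      (fun y hy => ?_) (left_mem_Icc.2 hc.2) (right_mem_Icc.2 hc.2) hc.2
    have hy' := hy
    rw [interior_Icc] at hy'
    rw [(hGd y (hsub y (interior_subset hy))).deriv]
    exact hsign y (hsub y (interior_subset hy)) (hpos y ⟨hy'.1, hy'.2.le⟩)
  rcases eq_or_ne (W β) 0 with h0 | h0
  · rw [h0, abs_zero]
    positivity
  -- Otherwise let `c` be the last point with `U ≤ 0`. Then `U c = 0`, the equation forces `W c =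
  -- 0`, and monotonicity on `[c, β]` gives `W β = 0`, which has been excluded.
  have hUpos : ∀ y ∈ Icc α β, 0 < U y := by
    by_contra! hcon
    set S := Icc α β ∩ U ⁻¹' Iic 0 with hS
    have hSne : S.Nonempty := hcon
    have hScl : IsClosed S := hU.preimage_isClosed_of_isClosed isClosed_Icc isClosed_Iic
    have hSb : BddAbove S := ⟨β, fun y hy => hy.1.2⟩
    obtain ⟨hcI, hcU⟩ := hScl.csSup_mem hSne hSb
    set c := sSup S with hc
    have habove : ∀ y ∈ Ioc c β, 0 < U y := fun y hy => by
      by_contra! hle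
      exact absurd (le_csSup hSb (show y ∈ S from ⟨⟨hcI.1.trans hy.1.le, hy.2⟩, hle⟩))
        (not_le.2 hy.1)
    have hcU0 : U c = 0 := by
      refine le_antisymm hcU ?_
      by_contra! hneg
      obtain ⟨y, hy, hy0⟩ := intermediate_value_Icc hcI.2
        (hU.mono (Icc_subset_Icc_left hcI.1)) (show (0 : ℝ) ∈ Icc (U c) (U β) from ⟨hneg.le, hβ.le⟩)
      rcases hy.1.eq_or_lt with rfl | hlt
      · exact hneg.ne hy0
      · exact (habove y ⟨hlt, hy.2⟩).ne' hy0
    have hWc : W c = 0 := by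
      have := heq c hcI
      rw [hcU0, zero_mul] at this
      have hpc := hm.trans_le (hp c hcI)
      rcases mul_eq_zero.1 this.symm with h | h
      · linarith
      · exact h
    have := hanti c hcI habove
    rw [hWc] at this
    have h5 : 0 < W β ^ 2 * Real.exp (2 * κ * β) := by positivity
    simp only [ne_eq, OfNat.ofNat_ne_zero, not_false_eq_true, zero_pow, zero_mul] at this
    linarith
  have h6 := hanti α (left_mem_Icc.2 hαβ) fun y hy => hUpos y (Ioc_subset_Icc_self hy)
  have h7 : W β ^ 2 ≤ (Real.exp (-(m * (β - α) / L)) * |W α|) ^ 2 := by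
    have h8 : (Real.exp (-(m * (β - α) / L)) * |W α|) ^ 2
        = W α ^ 2 * Real.exp (2 * κ * α) * Real.exp (-(2 * κ * β)) := by
      rw [mul_pow, sq_abs, ← Real.exp_nat_mul, mul_assoc, ← Real.exp_add, mul_comm]
      congr 2
      rw [hκ]
      push_cast
      ring
    rw [h8]
    calc W β ^ 2 = W β ^ 2 * Real.exp (2 * κ * β) * Real.exp (-(2 * κ * β)) := by
          rw [mul_assoc, ← Real.exp_add, add_neg_cancel, Real.exp_zero, mul_one]
      _ ≤ _ := mul_le_mul_of_nonneg_right h6 (Real.exp_pos _).le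
  exact abs_le_of_sq_le_sq h7 (by positivity)

/-- The mirror image of `abs_le_exp_mul_of_mul_deriv`. -/
theorem abs_le_exp_mul_of_mul_deriv_left {U W W' p : ℝ → ℝ} {α β m L : ℝ} (hαβ : α ≤ β)
    (hm : 0 < m) (hL : 0 < L) (hU : ContinuousOn U (Icc α β))
    (hW : ∀ y ∈ Icc α β, HasDerivAt W (W' y) y)
    (heq : ∀ y ∈ Icc α β, U y * W' y = -p y * W y) (hp : ∀ y ∈ Icc α β, m ≤ p y)
    (hUL : ∀ y ∈ Icc α β, -L ≤ U y) (hα : U α < 0) :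
    |W α| ≤ Real.exp (-(m * (β - α) / L)) * |W β| := by
  have hmem : ∀ y ∈ Icc (-β) (-α), -y ∈ Icc α β := fun y hy =>
    ⟨by linarith [hy.2], by linarith [hy.1]⟩
  -- Under `y ↦ -y` the derivative of `W` changes sign; replacing `U` by `-U` restores the equation.
  have key := abs_le_exp_mul_of_mul_deriv (U := fun y => -U (-y)) (W := fun y => W (-y))
    (W' := fun y => -W' (-y)) (p := fun y => p (-y)) (neg_le_neg hαβ) hm hL
    ((hU.comp continuous_neg.continuousOn hmem).neg) (fun y hy => ?_)
    (fun y hy => by simpa using heq _ (hmem y hy)) (fun y hy => hp _ (hmem y hy))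
    (fun y hy => by linarith [hUL _ (hmem y hy)]) (by simpa using hα)
  · simp only [neg_neg] at key
    convert key using 4
    ring
  · have := (hW (-y) (hmem y hy)).scomp y (hasDerivAt_neg y)
    exact this.congr_deriv (by simp)

/-- Any slow manifold is exponentially close to the graph `x = e^{-1/y} + ε μ`. -/
theorem exponentially_close_of_isSlowManifold {μ δ a b : ℝ} {Y : ℝ → ℝ → ℝ} (ha : 0 < a)
    (haδ : a < δ) (hδb : δ < b) (hY : IsSlowManifold μ a b Y) :
    ∃ k c ε₁ : ℝ, 0 < c ∧ 0 < ε₁ ∧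
      ∀ ε ∈ Ioo 0 ε₁, |Y ε δ - (expNegInvGlue δ + ε * μ)| ≤ k * Real.exp (-c / ε) := by
  obtain ⟨ε₀, K, hε₀, hYε⟩ := hY
  set m := expNegInvGlue a / b ^ 2 with hm
  -- Adding `1` makes `l` positive whatever `K` is. Below, `d` is half the distance from `δ` to the
  -- nearer end, so `δ ± d` stay in `(a, b)`, where `Y ε` is differentiable.
  set l := |K| + 1 with hl
  set d := min (δ - a) (b - δ) / 2 with hd
  have hb : 0 < b := by linarith
  have hm0 : 0 < m := div_pos (expNegInvGlue.pos_of_pos ha) (by positivity)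
  have hl0 : 0 < l := by positivity
  have hd0 : 0 < d := half_pos (lt_min (by linarith) (by linarith))
  have hda : d < δ - a := by
    have := min_le_left (δ - a) (b - δ)
    linarith
  have hdb : d < b - δ := by
    have := min_le_right (δ - a) (b - δ)
    linarith
  refine ⟨(l + |μ|) * ε₀, m * d / l, ε₀, by positivity, hε₀, fun ε hε => ?_⟩
  obtain ⟨hC, hinv, hclose⟩ := hYε ε hε
  have hε0 : 0 < ε := hε.1
  set U : ℝ → ℝ := fun y => Y ε y - expNegInvGlue y with hUdef
  set W : ℝ → ℝ := fun y => Y ε y - (expNegInvGlue y + ε * μ) with hWdef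
  have hUb : ∀ y ∈ Icc a b, |U y| ≤ l * ε := fun y hy =>
    (hclose y hy).trans (mul_le_mul_of_nonneg_right (by linarith [le_abs_self K]) hε0.le)
  have hWb : ∀ y ∈ Icc a b, |W y| ≤ (l + |μ|) * ε₀ := fun y hy => by
    have h1 : W y = U y - ε * μ := by simp only [hUdef, hWdef]; ring
    calc |W y| ≤ |U y| + |ε * μ| := by rw [h1]; exact abs_sub _ _
      _ ≤ l * ε + ε * |μ| := by
        rw [abs_mul, abs_of_pos hε0]
        linarith [hUb y hy]
      _ = (l + |μ|) * ε := by ring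
      _ ≤ _ := mul_le_mul_of_nonneg_left hε.2.le (by positivity)
  have hYd : ∀ y ∈ Ioo a b, HasDerivAt (Y ε) (deriv (Y ε) y) y := fun y hy =>
    ((hC.contDiffAt (Icc_mem_nhds hy.1 hy.2)).differentiableAt one_ne_zero).hasDerivAt
  have hWd : ∀ y ∈ Ioo a b,
      HasDerivAt W (deriv (Y ε) y - expNegInvGlue y / y ^ 2) y := fun y hy =>
    (hYd y hy).sub ((hasDerivAt_expNegInvGlue (ha.trans hy.1)).add_const _)
  have hUc : ∀ y ∈ Ioo a b, ContinuousAt U y := fun y hy =>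
    (hYd y hy).continuousAt.sub (hasDerivAt_expNegInvGlue (ha.trans hy.1)).continuousAt
  -- Tangency reads `U Y' = ε μ q / y²` with `q = e^{-1/y}`; subtracting `U q / y²` leaves `-(q /
  -- y²) (U - ε μ)`, and `W = U - ε μ`.
  have heq : ∀ y ∈ Ioo a b, U y * (deriv (Y ε) y - expNegInvGlue y / y ^ 2)
      = -(expNegInvGlue y / y ^ 2) * W y := fun y hy => by
    have h1 := tangent_of_locallyInvariant hinv hy (hYd y hy)
    have hy0 : y ≠ 0 := (ha.trans hy.1).ne'
    simp only [hUdef, hWdef]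
    field_simp
    linear_combination -h1
  have hp : ∀ y ∈ Ioo a b, m ≤ expNegInvGlue y / y ^ 2 := fun y hy => by
    have hy0 : 0 < y := ha.trans hy.1
    exact div_le_div₀ (expNegInvGlue.nonneg _) (expNegInvGlue.monotone hy.1.le) (by positivity)
      (pow_le_pow_left₀ hy0.le hy.2.le 2)
  have hLε : 0 < l * ε := by positivity
  have hexp : -(m * d / (l * ε)) = -(m * d / l) / ε := by
    field_simp
  have hfin : ∀ w, |w| ≤ (l + |μ|) * ε₀ → Real.exp (-(m * d / (l * ε))) * |w| ≤
      (l + |μ|) * ε₀ * Real.exp (-(m * d / l) / ε) := fun w hw => by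
    rw [hexp, mul_comm]
    exact mul_le_mul_of_nonneg_right hw (Real.exp_pos _).le
  change |W δ| ≤ _
  -- The sign of `U δ` is that of `y'` at `δ`, so it tells from which side the flow arrives; the
  -- comparison runs over an interval of length `d` on that side. If `U δ = 0`, the equation gives
  -- `W δ = 0` at once.
  rcases lt_trichotomy (U δ) 0 with hneg | hzero | hpos
  · have hsub : ∀ y ∈ Icc δ (δ + d), y ∈ Ioo a b := fun y hy =>
      ⟨by linarith [hy.1], by linarith [hy.2]⟩
    have := abs_le_exp_mul_of_mul_deriv_left (by linarith) hm0 hLε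
      (fun y hy => (hUc y (hsub y hy)).continuousWithinAt) (fun y hy => hWd y (hsub y hy))
      (fun y hy => heq y (hsub y hy)) (fun y hy => hp y (hsub y hy))
      (fun y hy => (abs_le.1 (hUb y (Ioo_subset_Icc_self (hsub y hy)))).1) hneg
    rw [add_sub_cancel_left] at this
    exact this.trans (hfin _ (hWb _ (Ioo_subset_Icc_self (hsub _ ⟨by linarith, le_rfl⟩))))
  · have h1 := heq δ ⟨haδ, hδb⟩
    rw [hzero, zero_mul] at h1
    have h2 := hp δ ⟨haδ, hδb⟩
    rcases mul_eq_zero.1 h1.symm with h | h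
    · linarith
    · rw [h, abs_zero]
      positivity
  · have hsub : ∀ y ∈ Icc (δ - d) δ, y ∈ Ioo a b := fun y hy =>
      ⟨by linarith [hy.1], by linarith [hy.2]⟩
    have := abs_le_exp_mul_of_mul_deriv (by linarith) hm0 hLε
      (fun y hy => (hUc y (hsub y hy)).continuousWithinAt) (fun y hy => hWd y (hsub y hy))
      (fun y hy => heq y (hsub y hy)) (fun y hy => hp y (hsub y hy))
      (fun y hy => (abs_le.1 (hUb y (Ioo_subset_Icc_self (hsub y hy)))).2) hpos
    rw [sub_sub_cancel] at this
    exact this.trans (hfin _ (hWb _ (Ioo_subset_Icc_self (hsub _ ⟨le_rfl, by linarith⟩))))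

/-! ### The end point `y_ε` and the blow-down -/

variable {μ δ ν ε : ℝ}

theorem yEnd_mem_Ioo (hδ : 0 < δ) (hε : ε ∈ Ioo 0 (ν * rho δ)) : yEnd ν ε ∈ Ioo 0 δ := by
  have hlog : 1 / δ < Real.log (ν / ε) := by
    have hν : 0 < ν := pos_of_mul_pos_left (hε.1.trans hε.2) (rho_nonneg δ)
    rw [Real.lt_log_iff_exp_lt (div_pos hν hε.1), lt_div_iff₀ hε.1]
    have h := hε.2
    rw [rho, expNegInvGlue_of_pos hδ, Real.exp_neg, ← div_eq_mul_inv,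
      lt_div_iff₀ (Real.exp_pos _)] at h
    rw [one_div]
    linarith
  have hpos : 0 < Real.log (ν / ε) := (one_div_pos.2 hδ).trans hlog
  exact ⟨one_div_pos.2 hpos, (one_div_lt hδ hpos).1 hlog⟩

theorem expNegInvGlue_yEnd (hν : 0 < ν) (hε : 0 < ε) (h : 0 < yEnd ν ε) :
    expNegInvGlue (yEnd ν ε) = ε / ν := by
  rw [expNegInvGlue_of_pos h, yEnd, one_div, inv_inv, Real.exp_neg,
    Real.exp_log (div_pos hν hε), inv_div]

/-- With `r₁ = q` and `ε₁ = ε / q`, the equation `x₁ = 1 + ε₁ μ` becomes `x = q + ε μ`, and `ε₁ ≤ ν`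
becomes `q ≥ ε / ν`, that is `y ≥ y_ε`. -/
theorem blowDown_eq_planarGraph (hδ : 0 < δ) (hν : 0 < ν) (hε : ε ∈ Ioo 0 (ν * rho δ)) :
    blowDown (graphM μ δ ν (fun _ => 0)) ε =
      planarGraph (fun y => expNegInvGlue y + ε * μ) (yEnd ν ε) δ := by
  have hy := (yEnd_mem_Ioo hδ hε).1
  have hq := expNegInvGlue_yEnd hν hε.1 hy
  ext ⟨x, y⟩
  constructor
  · rintro ⟨⟨r, x₁, y', e⟩, ⟨hM, hr, hre⟩, hxy⟩
    rw [mem_graphM_zero] at hM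
    simp only [kappa, Prod.mk.injEq] at hM hr hre hxy
    obtain ⟨h1, h2, h3, rfl⟩ := hM
    obtain ⟨rfl, rfl⟩ := hxy
    refine ⟨⟨?_, h2.2⟩, ?_⟩
    · by_contra! hlt
      have hr0 : 0 < r := pos_of_mul_pos_left (hre.symm ▸ hε.1) h3.1
      have hy'0 : 0 < y' := by
        by_contra! hle
        rw [hr, expNegInvGlue.zero_of_nonpos hle] at hr0
        exact lt_irrefl _ hr0
      have hrlt : r < ε / ν := by
        rw [hr, ← hq, expNegInvGlue_of_pos hy'0, expNegInvGlue_of_pos hy, Real.exp_lt_exp,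
          neg_lt_neg_iff]
        exact (inv_lt_inv₀ hy hy'0).2 hlt
      rw [lt_div_iff₀ hν] at hrlt
      have : r * e ≤ r * ν := mul_le_mul_of_nonneg_left h3.2 hr0.le
      linarith
    · simp only
      rw [← hr, ← hre]
      ring
  · rintro ⟨⟨hy1, hy2⟩, hx⟩
    simp only at hy1 hy2 hx
    have hy0 : 0 < y := hy.trans_le hy1
    have hq0 : 0 < expNegInvGlue y := expNegInvGlue.pos_of_pos hy0
    have hqle : ε / ν ≤ expNegInvGlue y := hq ▸ expNegInvGlue.monotone hy1
    refine ⟨(expNegInvGlue y, 1 + ε / expNegInvGlue y * μ, y, ε / expNegInvGlue y),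
      ⟨mem_graphM_zero.2 ⟨⟨hq0.le, expNegInvGlue.monotone hy2⟩, ⟨hy0.le, hy2⟩,
        ⟨div_nonneg hε.1.le hq0.le, ?_⟩, rfl⟩, rfl, ?_⟩, ?_⟩
    · rw [div_le_iff₀ hν] at hqle
      rw [div_le_iff₀ hq0]
      linarith
    · simp only
      field_simp
    · simp only [kappa, Prod.mk.injEq, and_true]
      rw [hx]
      field_simp

theorem yEnd_isBigO (hν0 : 0 < ν) (hν : ν ≤ 1) :
    (fun ε => yEnd ν ε) =O[𝓝[>] (0 : ℝ)] (fun ε => 1 / Real.log ε⁻¹) := by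
  refine IsBigO.of_bound 2 ?_
  filter_upwards [Ioo_mem_nhdsGT (show (0 : ℝ) < ν ^ 2 / 2 by positivity)] with ε hε
  have hε1 : ε < ν ^ 2 := by
    have : 0 < ν ^ 2 := by positivity
    linarith [hε.2]
  -- From `ε < ν²` it follows that `ln (ν/ε) ≥ ½ ln (1/ε)`, which is the source of the constant `2`.
  have hlog : Real.log ε < 2 * Real.log ν := by
    have := Real.log_lt_log hε.1 hε1
    rwa [Real.log_pow] at this
  have hlogν : Real.log ν ≤ 0 := Real.log_nonpos hν0.le hν
  have h1 : 0 < Real.log ε⁻¹ := by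
    rw [Real.log_inv]
    linarith
  have h2 : Real.log ε⁻¹ / 2 ≤ Real.log (ν / ε) := by
    rw [Real.log_inv, Real.log_div hν0.ne' hε.1.ne']
    linarith
  rw [yEnd, Real.norm_of_nonneg (one_div_nonneg.2 (by linarith)),
    Real.norm_of_nonneg (one_div_nonneg.2 h1.le)]
  calc 1 / Real.log (ν / ε) ≤ 1 / (Real.log ε⁻¹ / 2) :=
        one_div_le_one_div_of_le (half_pos h1) h2
    _ = 2 * (1 / Real.log ε⁻¹) := by field_simp

end Flat
end FlatSlow

/-! ### Assembly of the proposition -/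

theorem proposition2p1 (μ : ℝ) (hμ : μ ≠ 0) :
    ∃ K δ₀ ν₀ ξ₀ : ℝ, 0 < K ∧ 0 < δ₀ ∧ 0 < ν₀ ∧ 0 < ξ₀ ∧
    ∀ δ ∈ Ioc 0 δ₀, ∀ ν ∈ Ioc 0 ν₀, ∀ ξ ∈ Ioc 0 ξ₀,
    ∃ h : ℝ × ℝ × ℝ → ℝ, ContDiff ℝ ∞ h ∧
      (∀ r ∈ Icc 0 (FlatSlow.rho δ), ∀ y ∈ Icc 0 δ, ∀ e ∈ Icc 0 ν, |h (r, y, e)| ≤ K * e) ∧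
      -- `M₁` is a center manifold within `U₁`, of every point of the line `L₁`
      (∀ y ∈ Icc 0 δ,
        FlatSlow.IsCenterManifold (FlatSlow.chartField μ) (FlatSlow.box δ ν ξ)
          (FlatSlow.graphM μ δ ν h) (0, 1, y, 0)) ∧
      -- `M₁` contains `S_{a,1}` within `ε₁ = 0` as a set of equilibria
      {z | z ∈ FlatSlow.graphM μ δ ν h ∧ z.2.2.2 = 0} =
        FlatSlow.critManifold ∩ FlatSlow.box δ ν ξ ∧
      (∀ z ∈ FlatSlow.critManifold, FlatSlow.chartField μ z = 0) ∧
      -- `C₁` is a center manifold within the invariant plane `r₁ = y = 0`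
      (∀ x e : ℝ, (FlatSlow.chartField μ (0, x, 0, e)).1 = 0 ∧
        (FlatSlow.chartField μ (0, x, 0, e)).2.2.1 = 0) ∧
      FlatSlow.IsCenterManifold (FlatSlow.planeField μ) (Icc 0 ξ⁻¹ ×ˢ Icc 0 ν)
        {p | (0, p.1, 0, p.2) ∈ FlatSlow.sliceC (FlatSlow.graphM μ δ ν h)} (1, 0) ∧
      -- the flow on `C₁`
      (μ < 0 →
        FlatSlow.IsOverflowing (FlatSlow.chartField μ)
          (FlatSlow.sliceC (FlatSlow.graphM μ δ ν h)) ν ∧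
        ∀ z ∈ FlatSlow.sliceC (FlatSlow.graphM μ δ ν h), 0 < z.2.2.2 →
          0 < (FlatSlow.chartField μ z).2.2.2) ∧
      (0 < μ →
        FlatSlow.IsInflowing (FlatSlow.chartField μ)
          (FlatSlow.sliceC (FlatSlow.graphM μ δ ν h)) ν ∧
        ∀ z ∈ FlatSlow.sliceC (FlatSlow.graphM μ δ ν h), 0 < z.2.2.2 →
          (FlatSlow.chartField μ z).2.2.2 < 0) ∧
      -- the extension of the slow manifold of the flat model
      ∃ X : ℝ → ℝ → ℝ,
        ContDiffOn ℝ ∞ (fun p : ℝ × ℝ => X p.1 p.2) {p | 0 < p.2} ∧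
        (∀ y, 0 < y → X 0 y = expNegInvGlue y) ∧
        (∀ ε ∈ Ioo 0 (ν * FlatSlow.rho δ),
          0 < FlatSlow.yEnd ν ε ∧ FlatSlow.yEnd ν ε < δ ∧
          FlatSlow.blowDown (FlatSlow.graphM μ δ ν h) ε =
            FlatSlow.planarGraph (X ε) (FlatSlow.yEnd ν ε) δ ∧
          FlatSlow.LocallyInvariant (FlatSlow.flatField μ ε)
            (FlatSlow.strip (FlatSlow.yEnd ν ε) δ)
            (FlatSlow.planarGraph (X ε) (FlatSlow.yEnd ν ε) δ) ∧
          (∀ y ∈ Icc (FlatSlow.yEnd ν ε) δ, |X ε y - expNegInvGlue y| ≤ K * ε) ∧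
          |X ε (FlatSlow.yEnd ν ε) - ε / ν * (1 + ν * μ)| ≤ K * ε * ν) ∧
        (∀ (a b : ℝ) (Y : ℝ → ℝ → ℝ), 0 < a → a < δ → δ < b →
          FlatSlow.IsSlowManifold μ a b Y →
          ∃ k c ε₁ : ℝ, 0 < c ∧ 0 < ε₁ ∧
            ∀ ε ∈ Ioo 0 ε₁, |Y ε δ - X ε δ| ≤ k * Real.exp (-c / ε)) ∧
        (fun ε => X ε (FlatSlow.yEnd ν ε)) =O[𝓝[>] (0 : ℝ)] (fun ε => ε) ∧
        (fun ε => FlatSlow.yEnd ν ε) =O[𝓝[>] (0 : ℝ)] (fun ε => 1 / Real.log ε⁻¹) := by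
  have hμ1 : 0 < 1 + |μ| := by positivity
  -- `K` must dominate `|X - e^{-1/y}| / ε = |μ|` and be positive even so; `ν₀` and `ξ₀` keep `1 +
  -- ε₁ μ` inside `[0, ξ⁻¹]`.
  refine ⟨1 + |μ|, 1, 1 / (1 + |μ|), 1 / 2, hμ1, one_pos, by positivity, by norm_num, ?_⟩
  rintro δ ⟨hδ, -⟩ ν ⟨hν0, hν⟩ ξ ⟨hξ0, hξ⟩
  have hν1 : ν ≤ 1 := hν.trans ((div_le_one hμ1).2 (by linarith [abs_nonneg μ]))
  -- Since `e^{-1/y_ε} = ε / ν`, the end-point value is exact: its error term is zero, and it is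
  -- linear in `ε`.
  have hend : ∀ ε ∈ Ioo 0 (ν * FlatSlow.rho δ),
      expNegInvGlue (FlatSlow.yEnd ν ε) + ε * μ = ε / ν * (1 + ν * μ) := fun ε hε => by
    rw [FlatSlow.expNegInvGlue_yEnd hν0 hε.1 (FlatSlow.yEnd_mem_Ioo hδ hε).1]
    field_simp
  refine ⟨fun _ => 0, contDiff_const, fun r _ y _ e he => ?_,
    fun y hy => FlatSlow.isCenterManifold_graphM hν0.le hν hξ0 hξ hy,
    FlatSlow.graphM_inter_eq_critManifold hξ0 hξ,
    fun z hz => FlatSlow.chartField_eq_zero_of_mem_critManifold hz,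
    fun x e => by simp [FlatSlow.chartField],
    FlatSlow.isCenterManifold_sliceC hδ.le hν0.le hν hξ0 hξ,
    fun hneg => ⟨FlatSlow.isOverflowing_sliceC hν0 hneg, fun z hz he => ?_⟩,
    fun hpos => ⟨FlatSlow.isInflowing_sliceC hν0 hpos, fun z hz he => ?_⟩,
    fun ε y => expNegInvGlue y + ε * μ, ?_, fun y _ => by simp, fun ε hε => ?_,
    fun a b Y ha haδ hδb hY => FlatSlow.exponentially_close_of_isSlowManifold ha haδ hδb hY,
    ?_, FlatSlow.yEnd_isBigO hν0 hν1⟩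
  · rw [abs_zero]
    exact mul_nonneg hμ1.le he.1
  · rw [FlatSlow.chartField_eps_of_mem_sliceC hz]
    exact mul_pos (neg_pos.2 hneg) (pow_pos he 2)
  · rw [FlatSlow.chartField_eps_of_mem_sliceC hz]
    exact mul_neg_of_neg_of_pos (neg_lt_zero.2 hpos) (pow_pos he 2)
  · exact ((expNegInvGlue.contDiff.comp contDiff_snd).add
      (contDiff_fst.mul contDiff_const)).contDiffOn
  · have hy := FlatSlow.yEnd_mem_Ioo hδ hε
    refine ⟨hy.1, hy.2, FlatSlow.blowDown_eq_planarGraph hδ hν0 hε,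
      FlatSlow.locallyInvariant_planarGraph μ ε hy.1, fun y _ => ?_, ?_⟩
    · rw [add_sub_cancel_left, abs_mul, abs_of_pos hε.1, mul_comm]
      exact mul_le_mul_of_nonneg_right (by linarith) hε.1.le
    · beta_reduce
      rw [hend ε hε, sub_self, abs_zero]
      exact mul_nonneg (mul_nonneg hμ1.le hε.1.le) hν0.le
  · refine IsBigO.of_bound |1 / ν * (1 + ν * μ)| ?_
    have hpos : 0 < ν * FlatSlow.rho δ := mul_pos hν0 (expNegInvGlue.pos_of_pos hδ)
    filter_upwards [Ioo_mem_nhdsGT hpos] with ε hε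
    rw [hend ε hε, Real.norm_eq_abs, Real.norm_eq_abs, ← abs_mul]
    exact le_of_eq (congrArg _ (by ring))
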